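/- **Proposition 4.2 (adjoint action, homological equation).** Let $I=\mathbb Z\times\{+1,-1\}$, and for $k=(j,\sigma)\in I$ put $\langle k\rangle=\max(|j|,1)$ and $\mathfrak m_k=\sigma j$. For $s>0$ let $\mathtt g_s$ be the space of $x\in\mathbb C^I$ with $|x|_s:=\big(\sum_{k}\langle k\rangle^2e^{2s\sqrt{\langle k\rangle}}|x_k|^2\big)^{1/2}<\infty$, and for $r>0$ let $B_r(\mathtt g_s)$ be its open ball of radius $r$ centred at $0$. For a formal vector field $V=\sum_{k\in I}\sum_{q\in\mathbb N^I_{\rm fin}}V^{(k)}_q x^q\partial_{x_k}$ put $$\|V\|_{s,r}:=\frac1r\sup_{x\in B_r(\mathtt g_s)}\big|\underline V(x)\big|_s\in[0,\infty],\qquad \underline V:=\sum_{k,q}|V_q^{(k)}|\,x^q\partial_{x_k}.$$ Let $\mathcal V_{s,r}$ be the set of those $V$ with $V(0)=0$, with $V_q^{(k)}=0$ whenever $\mathfrak m\cdot(q-e_k)\neq0$, and with $\|V\|_{s,r}<\infty$. For $\lambda\in\mathbb C^I$ let $L_\lambda V:=[\mathtt D(\lambda),V]$ with $\mathtt D(\lambda)=\sum_k\lambda_kx_k\partial_{x_k}$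 and $[X,Y]=\sum_j\big(X[Y^{(j)}]-Y[X^{(j)}]\big)\partial_{x_j}$, so that $L_\lambda(x^q\partial_{x_k})=\lambda\cdot(q-e_k)\,x^q\partial_{x_k}$; it takes values in formal vector fields. Let $$\mathcal R_{s,r}:=\{V\in\mathcal V_{s,r}:\ V^{(k)}_q=0\ \text{whenever}\ \lambda\cdot(q-e_k)=0\},$$ the complement in $\mathcal V_{s,r}$ of the kernel of $L_\lambda$. Let $\Delta_\lambda$ be the set of finitely supported $P\in\mathbb Z^I$ with $\lambda\cdot P=0$, $\mathfrak m\cdot P=0$ and $P+e_k\in\mathbb N^I$ for some $k\in I$. Let $\tau>0$ and $C>0$. Then there are constants $\mathtt c>0$ and $K>0$, depending only on $\tau$ and $C$, such that the following holds for every $\gamma>0$ and every $\lambda\in\mathbb C^I$ satisfying: 1. $\lambda_k\ne0$ for all $k\in I$; 2. there are $\varphi_k\in\mathbb R$ $(k\in I)$ with $|\lambda_k-\langle k\rangle^2e^{i\varphi_k}|\le\frac12$ for all $k\in I$, and with $|e^{i\varphi_{(j,\sigma)}}-e^{i\varphi_{(-j,-\sigma)}}|\ge C$ for all $(j,\sigma)\in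 I$ such that $\lambda_{(j,\sigma)}\neq\lambda_{(-j,-\sigma)}$; 3. $\lambda$ is $(\gamma,\tau)$-Diophantine modulo $\Delta_\lambda$: $|\lambda\cdot p|\ge\gamma\prod_{i\in I}(1+p_i^2\langle i\rangle^2)^{-\tau}$ for all finitely supported $p\in\mathbb Z^I\setminus\Delta_\lambda$ with $\mathfrak m\cdot p=0$ and $p+e_k\in\mathbb N^I$ for some $k\in I$. For all $s,r>0$ and every $Y\in\mathcal R_{s,r}$ there is a formal vector field $X$ with $L_\lambda X=Y$ such that, for every $\delta>0$, $X$ belongs to $\mathcal R_{s+\delta,r}$, it is the only solution of $L_\lambda X=Y$ in $\mathcal R_{s+\delta,r}$, and $$\|X\|_{s+\delta,r}\le K\,e^{\mathtt c/\delta^6}\,\gamma^{-1}\,\|Y\|_{s,r}.$$ -/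

import Mathlib

open scoped ENNReal

noncomputable section

namespace AnalyticVF

/-- The index set `I = ℤ × {+1, -1}` (recall that `ℤˣ = {1, -1}`). -/
abbrev Idx : Type := ℤ × ℤˣ

/-- `⟨(j, σ)⟩ = max (|j|, 1)`. -/
def jap (k : Idx) : ℝ := max |(k.1 : ℝ)| 1

/-- The momentum `𝔪_(j, σ) = σ j`. -/
def mom (k : Idx) : ℤ := (k.2 : ℤ) * k.1

/-- `𝔪 · p` for a finitely supported integer vector `p`. -/
def momDot (p : Idx →₀ ℤ) : ℤ := p.sum fun i a => mom i * a

/-- `lam · p` for a finitely supported integer vector `p`. -/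
def freqDot (lam : Idx → ℂ) (p : Idx →₀ ℤ) : ℂ := p.sum fun i a => lam i * (a : ℂ)

/-- The vector `q - e_k`, for `q` a finitely supported vector of natural numbers. -/
def subUnit (q : Idx →₀ ℕ) (k : Idx) : Idx →₀ ℤ :=
  q.mapRange (fun n : ℕ => (n : ℤ)) Nat.cast_zero - Finsupp.single k 1

/-- Formal vector fields `V = ∑_k V^(k)(x) ∂/∂x_k`: each component is a formal power series in the
variables `(x_k)_{k ∈ I}`, and `V_q^(k) = MvPowerSeries.coeff q (V k)`. -/
abbrev FormalVF : Type := Idx → MvPowerSeries Idx ℂ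

/-- The action `X[f] = ∑_k X^(k) ∂f/∂x_k` of a vector field on a power series, the sum being taken
coefficient by coefficient.  It is used only where each coefficient is a finite sum. -/
def applyVF (X : FormalVF) (f : MvPowerSeries Idx ℂ) : MvPowerSeries Idx ℂ :=
  fun q => ∑ᶠ k : Idx, MvPowerSeries.coeff q (X k * MvPowerSeries.pderiv ℂ k f)

/-- The Lie bracket `[X, Y] = ∑_j (X[Y^(j)] - Y[X^(j)]) ∂/∂x_j`. -/
def lieBracket (X Y : FormalVF) : FormalVF :=
  fun j => applyVF X (Y j) - applyVF Y (X j)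

/-- The diagonal linear vector field `D(lam) = ∑_k lam_k x_k ∂/∂x_k`. -/
def diagVF (lam : Idx → ℂ) : FormalVF :=
  fun k => MvPowerSeries.monomial (Finsupp.single k 1) (lam k)

/-- The operator `L_lam Y = [D(lam), Y]`, with values in formal vector fields. -/
def lieDiag (lam : Idx → ℂ) (Y : FormalVF) : FormalVF := lieBracket (diagVF lam) Y

theorem freqDot_subUnit (lam : Idx → ℂ) (q : Idx →₀ ℕ) (k : Idx) :
    freqDot lam (subUnit q k) = (q.sum fun i n => lam i * (n : ℂ)) - lam k := by
  unfold freqDot subUnit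
  rw [Finsupp.sum_sub_index (by intros; push_cast; ring), Finsupp.sum_mapRange_index (by simp),
    Finsupp.sum_single_index (by simp)]
  simp

/-- `L_lam` acts diagonally on monomials: `(L_lam Y)_q^(k) = lam · (q - e_k) Y_q^(k)`. -/
theorem coeff_lieDiag (lam : Idx → ℂ) (Y : FormalVF) (k : Idx) (q : Idx →₀ ℕ) :
    MvPowerSeries.coeff q (lieDiag lam Y k)
      = freqDot lam (subUnit q k) * MvPowerSeries.coeff q (Y k) := by
  have h1 : MvPowerSeries.coeff q (applyVF (diagVF lam) (Y k))
      = (q.sum fun i n => lam i * (n : ℂ)) * MvPowerSeries.coeff q (Y k) := by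
    have e : ∀ i : Idx, MvPowerSeries.coeff q (diagVF lam i * MvPowerSeries.pderiv ℂ i (Y k))
        = lam i * (q i : ℂ) * MvPowerSeries.coeff q (Y k) := by
      intro i
      unfold diagVF
      rw [MvPowerSeries.coeff_monomial_mul]
      by_cases hi : q i = 0
      · rw [if_neg, hi]
        · simp
        · intro h
          have := h i
          simp [hi] at this
      · have hle : Finsupp.single i 1 ≤ q := by
          rw [Finsupp.single_le_iff]; omega
        rw [if_pos hle]
        rw [MvPowerSeries.coeff_pderiv, tsub_add_cancel_of_le hle, Finsupp.tsub_apply,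
          Finsupp.single_eq_same, Nat.cast_sub (by omega)]
        push_cast
        ring
    change (∑ᶠ i : Idx, MvPowerSeries.coeff q (diagVF lam i * MvPowerSeries.pderiv ℂ i (Y k))) = _
    simp_rw [e]
    rw [finsum_eq_sum_of_support_subset (s := q.support), Finsupp.sum, Finset.sum_mul]
    intro i hi
    rw [Function.mem_support] at hi
    simp only [Finset.mem_coe, Finsupp.mem_support_iff]
    intro h
    simp [h] at hi
  have h2 : MvPowerSeries.coeff q (applyVF Y (diagVF lam k))
      = lam k * MvPowerSeries.coeff q (Y k) := by
    have e : ∀ i : Idx, MvPowerSeries.pderiv ℂ i (diagVF lam k)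
        = if i = k then MvPowerSeries.C (lam k) else 0 := by
      intro i
      ext m
      rw [MvPowerSeries.coeff_pderiv]
      unfold diagVF
      rw [MvPowerSeries.coeff_monomial]
      by_cases hik : i = k
      · subst hik
        rw [if_pos rfl, MvPowerSeries.coeff_C]
        by_cases hm : m = 0
        · subst hm; simp
        · simp [hm]
      · rw [if_neg hik, if_neg]
        · simp
        · intro h
          have := DFunLike.congr_fun h i
          simp [Ne.symm hik] at this
    change (∑ᶠ i : Idx, MvPowerSeries.coeff q (Y i * MvPowerSeries.pderiv ℂ i (diagVF lam k))) = _
    rw [finsum_eq_single _ k]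
    · rw [e k, if_pos rfl, MvPowerSeries.coeff_mul_C, mul_comm]
    · intro i hi
      rw [e i, if_neg hi]
      simp
  have h3 : MvPowerSeries.coeff q (lieDiag lam Y k)
      = MvPowerSeries.coeff q (applyVF (diagVF lam) (Y k))
        - MvPowerSeries.coeff q (applyVF Y (diagVF lam k)) := rfl
  rw [h3, h1, h2, freqDot_subUnit]
  ring

/-- The norm of the weighted space `g_s`, for a sequence `a` of absolute values:
`(∑_k ⟨k⟩² e^{2 s √⟨k⟩} a_k²)^{1/2}`, possibly infinite. -/
def gNorm (s : ℝ) (a : Idx → ℝ≥0∞) : ℝ≥0∞ :=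
  (∑' k : Idx, ENNReal.ofReal (jap k ^ 2 * Real.exp (2 * s * √(jap k))) * a k ^ 2) ^ (1 / 2 : ℝ)

/-- The open ball `B_r(g_s)`. -/
def gBall (s r : ℝ) : Set (Idx → ℂ) :=
  {x | gNorm s (fun k => ‖x k‖ₑ) < ENNReal.ofReal r}

/-- The components `∑_q |V_q^(k)| |x^q|` of the majorant field of `V` at `(|x_k|)_k`. -/
def majorant (V : FormalVF) (x : Idx → ℂ) (k : Idx) : ℝ≥0∞ :=
  ∑' q : Idx →₀ ℕ, ‖MvPowerSeries.coeff q (V k)‖ₑ * q.prod fun h n => ‖x h‖ₑ ^ n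

/-- The majorant norm `‖V‖_{s,r} = r⁻¹ sup_{x ∈ B_r(g_s)} |V̲(x)|_s` with values in `[0, ∞]`, where
`V̲` is the vector field with coefficients `|V_q^(k)|`.  Since the ball is invariant under
`x ↦ (|x_k|)_k`, and `|V̲(x)|_s` is largest at points with nonnegative entries, the supremum may be
computed with `|x_k|` in place of `x_k`; then all series have nonnegative terms. -/
def majNorm (s r : ℝ) (V : FormalVF) : ℝ≥0∞ :=
  (ENNReal.ofReal r)⁻¹ * ⨆ x ∈ gBall s r, gNorm s (majorant V x)

/-- The space `𝒱_{s,r}`: vector fields that vanish at the origin, preserve momentum and have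
finite majorant norm. -/
def admissible (s r : ℝ) : Set FormalVF :=
  {V | (∀ k, MvPowerSeries.coeff 0 (V k) = 0) ∧
    (∀ k q, momDot (subUnit q k) ≠ 0 → MvPowerSeries.coeff q (V k) = 0) ∧
    majNorm s r V < ∞}

/-- The complement `ℛ_{s,r}` in `𝒱_{s,r}` of the kernel of `L_lam`: the fields in `𝒱_{s,r}` that
contain no monomial `x^q ∂/∂x_k` with `lam · (q - e_k) = 0`. -/
def rangeSpace (lam : Idx → ℂ) (s r : ℝ) : Set FormalVF :=
  {V | V ∈ admissible s r ∧
    ∀ k q, freqDot lam (subUnit q k) = 0 → MvPowerSeries.coeff q (V k) = 0}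

/-- The resonance module
`Δ_lam = {P : lam · P = 0, 𝔪 · P = 0, P + e_k ∈ ℕ^I for some k}`. -/
def resonances (lam : Idx → ℂ) : Set (Idx →₀ ℤ) :=
  {P | freqDot lam P = 0 ∧ momDot P = 0 ∧ ∃ k, 0 ≤ P + Finsupp.single k 1}

/-- `lam` is `(γ, τ)`-Diophantine modulo `Δ_lam`.  Factors with `p_i = 0` are equal to `1`. -/
def IsDiophantine (lam : Idx → ℂ) (γ τ : ℝ) : Prop :=
  ∀ p : Idx →₀ ℤ, p ∉ resonances lam → momDot p = 0 →
    (∃ k, 0 ≤ p + Finsupp.single k 1) →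
      γ * (p.prod fun i a => 1 / (1 + (a : ℝ) ^ 2 * jap i ^ 2) ^ τ) ≤ ‖freqDot lam p‖

/-- Superlinear frequencies (with exponent `2` and separation constant `C`): there are phases
`φ_k` with `|lam_k - ⟨k⟩² e^{i φ_k}| ≤ 1/2`, and `|e^{i φ_(j,σ)} - e^{i φ_(-j,-σ)}| ≥ C`
whenever `lam_(j,σ) ≠ lam_(-j,-σ)`. -/
def IsSuperlinear (lam : Idx → ℂ) (C : ℝ) : Prop :=
  ∃ φ : Idx → ℝ,
    (∀ k, ‖lam k - (jap k : ℂ) ^ 2 * Complex.exp (Complex.I * φ k)‖ ≤ 1 / 2) ∧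
    ∀ (j : ℤ) (σ : ℤˣ), lam (j, σ) ≠ lam (-j, -σ) →
      C ≤ ‖Complex.exp (Complex.I * φ (j, σ)) - Complex.exp (Complex.I * φ (-j, -σ))‖

end AnalyticVF

end

open AnalyticVF

/-! On the monomial `x^q ∂/∂x_k` the operator `L_lam` is multiplication by `lam · (q - e_k)`, so `X`
is obtained from `Y` by dividing by these numbers. Passing from `s` to `s + δ` multiplies the
coefficient of this monomial by `exp (-δ (∑ᵢ qᵢ √⟨i⟩ - √⟨k⟩))`. Single out a factor `x_a` of `x^q`
with `⟨a⟩` largest. By momentum conservation and concavity of the square root, the exponent is at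
least `δ / 2` times the weighted degree `T` of the remaining factors. If the divisor is small, then
superlinearity and the separation of phases leave two cases: either `lam_a = lam_k` and
`𝔪_a = 𝔪_k`, and the divisor does not involve `a` and `k`, or `⟨a⟩` and `⟨k⟩` are at most a constant
times `1 + T ^ 4`. In both cases the Diophantine bound costs only a power of `1 + T ^ 4` and of
`∏ᵢ (1 + pᵢ² ⟨i⟩²)` over the remaining factors, which `exp (δ T / 2)` absorbs up to
`exp (c / δ ^ 6)`. -/

namespace AnalyticVF

variable {lam : Idx → ℂ} {p : Idx →₀ ℤ} {q : Idx →₀ ℕ} {i a k : Idx} {s δ r τ τ' C γ ε : ℝ}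

/-! ### Weights and momentum -/

theorem one_le_jap (k : Idx) : 1 ≤ jap k := le_max_right _ _

theorem jap_pos (k : Idx) : 0 < jap k := one_pos.trans_le (one_le_jap k)

theorem one_le_sqrt_jap (k : Idx) : 1 ≤ √(jap k) := Real.one_le_sqrt.2 (one_le_jap k)

theorem abs_mom (k : Idx) : |mom k| = |k.1| := by
  rcases Int.units_eq_one_or k.2 with h | h <;> simp [mom, h]

theorem jap_eq_max_abs_mom (k : Idx) : jap k = ((max |mom k| 1 : ℤ) : ℝ) := by
  rw [abs_mom]
  simp [jap]

theorem abs_mom_le_jap (k : Idx) : |(mom k : ℝ)| ≤ jap k := by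
  rw [jap_eq_max_abs_mom]
  exact_mod_cast le_max_left _ _

theorem jap_add_jap_le_abs_sq_sub_sq (h : jap a ≠ jap k) :
    jap a + jap k ≤ |jap a ^ 2 - jap k ^ 2| := by
  have hgap : 1 ≤ |jap a - jap k| := by
    rw [← sub_ne_zero] at h
    rw [jap_eq_max_abs_mom, jap_eq_max_abs_mom] at *
    exact_mod_cast Int.one_le_abs (by exact_mod_cast h)
  have hsum : 0 < jap a + jap k := add_pos (jap_pos a) (jap_pos k)
  rw [sq_sub_sq, abs_mul, abs_of_pos hsum]
  exact le_mul_of_one_le_right hsum.le hgap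

theorem jap_le_abs_mom_sub (hjap : jap a = jap k) (hmom : mom a ≠ mom k) :
    jap a ≤ |(mom a : ℝ) - mom k| := by
  rw [jap_eq_max_abs_mom, jap_eq_max_abs_mom] at hjap
  have hmax : max |mom a| 1 = max |mom k| 1 := by exact_mod_cast hjap
  have : max |mom a| 1 ≤ |mom a - mom k| := by grind
  rw [jap_eq_max_abs_mom]
  exact_mod_cast this

theorem eq_or_eq_neg_of_mom_eq (h : mom a = mom k) : k = a ∨ k = (-a.1, -a.2) := by
  obtain ⟨j, σ⟩ := a
  obtain ⟨j', σ'⟩ := k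
  simp only [mom, Prod.mk.injEq] at *
  rcases Int.units_eq_one_or σ with rfl | rfl <;> rcases Int.units_eq_one_or σ' with rfl | rfl <;>
    simp at h ⊢ <;> omega

/-- The exponent vector `q`, regarded as an integer vector so that `q - e_k` makes sense. -/
noncomputable def toInt (q : Idx →₀ ℕ) : Idx →₀ ℤ :=
  q.mapRange (fun n : ℕ => (n : ℤ)) Nat.cast_zero

theorem toInt_add_single_nonneg (q : Idx →₀ ℕ) (k : Idx) : 0 ≤ toInt q + Finsupp.single k 1 :=
  add_nonneg (fun _ => Int.natCast_nonneg _) (Finsupp.single_nonneg.2 zero_le_one)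

theorem subUnit_add_single (q : Idx →₀ ℕ) (a k : Idx) :
    subUnit (q + Finsupp.single a 1) k = toInt q + Finsupp.single a 1 - Finsupp.single k 1 := by
  ext i
  simp only [subUnit, toInt, Finsupp.coe_sub, Finsupp.coe_add, Pi.sub_apply, Pi.add_apply,
    Finsupp.mapRange_apply, Finsupp.single_apply, Nat.cast_add, Nat.cast_ite, Nat.cast_one,
    Nat.cast_zero]

theorem momDot_toInt (q : Idx →₀ ℕ) : momDot (toInt q) = q.sum fun i n => mom i * (n : ℤ) :=
  Finsupp.sum_mapRange_index (by simp)

theorem freqDot_toInt (lam : Idx → ℂ) (q : Idx →₀ ℕ) :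
    freqDot lam (toInt q) = q.sum fun i n => lam i * (n : ℂ) := by
  rw [freqDot, toInt, Finsupp.sum_mapRange_index (by simp)]
  simp only [Int.cast_natCast]

theorem momDot_single (k : Idx) : momDot (Finsupp.single k 1) = mom k := by
  simp [momDot]

theorem freqDot_single (lam : Idx → ℂ) (k : Idx) : freqDot lam (Finsupp.single k 1) = lam k := by
  simp [freqDot]

theorem momDot_subUnit_add_single (q : Idx →₀ ℕ) (a k : Idx) :
    momDot (subUnit (q + Finsupp.single a 1) k) = momDot (toInt q) + (mom a - mom k) := by
  rw [← momDot_single a, ← momDot_single k, subUnit_add_single, momDot,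
    Finsupp.sum_sub_index (by intros; ring), Finsupp.sum_add_index' (by simp) (by intros; ring),
    add_sub_assoc]
  rfl

theorem freqDot_subUnit_add_single (lam : Idx → ℂ) (q : Idx →₀ ℕ) (a k : Idx) :
    freqDot lam (subUnit (q + Finsupp.single a 1) k)
      = freqDot lam (toInt q) + (lam a - lam k) := by
  rw [freqDot_subUnit, freqDot_toInt,
    Finsupp.sum_add_index' (by simp) (by intros; push_cast; ring),
    Finsupp.sum_single_index (by simp), Nat.cast_one, mul_one, add_sub_assoc]

theorem exists_eq_add_single_of_jap_le (hq : q ≠ 0) :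
    ∃ q' a, q = q' + Finsupp.single a 1 ∧ ∀ i ∈ q'.support, jap i ≤ jap a := by
  obtain ⟨a, ha, hmax⟩ := q.support.exists_max_image jap (Finsupp.support_nonempty_iff.2 hq)
  have hle : Finsupp.single a 1 ≤ q :=
    Finsupp.single_le_iff.2 (Nat.one_le_iff_ne_zero.2 (Finsupp.mem_support_iff.1 ha))
  exact ⟨q - Finsupp.single a 1, a, (tsub_add_cancel_of_le hle).symm,
    fun i hi => hmax i (Finsupp.support_mono tsub_le_self hi)⟩

/-! ### The weighted degree -/

/-- The weighted degree `∑ᵢ qᵢ √⟨i⟩`: the factor `exp (δ (sqrtDeg q - √⟨k⟩))` is what the monomial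
`x^q ∂/∂x_k` gains when the radius of analyticity grows from `s` to `s + δ`. -/
noncomputable def sqrtDeg (q : Idx →₀ ℕ) : ℝ := q.sum fun i n => (n : ℝ) * √(jap i)

theorem sqrtDeg_nonneg (q : Idx →₀ ℕ) : 0 ≤ sqrtDeg q :=
  Finset.sum_nonneg fun _ _ => by positivity

theorem sqrtDeg_add_single (q : Idx →₀ ℕ) (a : Idx) :
    sqrtDeg (q + Finsupp.single a 1) = sqrtDeg q + √(jap a) := by
  rw [sqrtDeg, Finsupp.sum_add_index' (by simp) (by intros; push_cast; ring),
    Finsupp.sum_single_index (by simp), Nat.cast_one, one_mul]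
  rfl

theorem sqrt_jap_le_sqrtDeg (hi : i ∈ q.support) : √(jap i) ≤ sqrtDeg q := by
  have hqi : (1 : ℝ) ≤ q i := by
    exact_mod_cast Nat.one_le_iff_ne_zero.2 (Finsupp.mem_support_iff.1 hi)
  calc √(jap i) ≤ (q i : ℝ) * √(jap i) := le_mul_of_one_le_left (Real.sqrt_nonneg _) hqi
    _ ≤ sqrtDeg q := Finset.single_le_sum (f := fun i => (q i : ℝ) * √(jap i))
        (fun _ _ => by positivity) hi

theorem sqrtDeg_eq_zero_or_one_le (q : Idx →₀ ℕ) : sqrtDeg q = 0 ∨ 1 ≤ sqrtDeg q := by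
  rcases q.support.eq_empty_or_nonempty with h | ⟨i, hi⟩
  · left
    rw [sqrtDeg, Finsupp.sum, h, Finset.sum_empty]
  · exact Or.inr ((one_le_sqrt_jap i).trans (sqrt_jap_le_sqrtDeg hi))

theorem sum_mul_sqrt_jap_pow_le (q : Idx →₀ ℕ) (m : ℕ) :
    (q.sum fun i n => (n : ℝ) * √(jap i) ^ (m + 1)) ≤ sqrtDeg q ^ (m + 1) := by
  calc (q.sum fun i n => (n : ℝ) * √(jap i) ^ (m + 1))
      ≤ q.sum fun i n => (n : ℝ) * √(jap i) * sqrtDeg q ^ m := by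
        refine Finset.sum_le_sum fun i hi => ?_
        beta_reduce
        rw [pow_succ', ← mul_assoc]
        gcongr
        exact sqrt_jap_le_sqrtDeg hi
    _ = sqrtDeg q ^ (m + 1) := by
        rw [pow_succ', Finsupp.sum, ← Finset.sum_mul]
        rfl

theorem abs_momDot_toInt_le (q : Idx →₀ ℕ) :
    |(momDot (toInt q) : ℝ)| ≤ q.sum fun i n => (n : ℝ) * jap i := by
  rw [momDot_toInt, Finsupp.sum, Int.cast_sum]
  refine (Finset.abs_sum_le_sum_abs _ _).trans (Finset.sum_le_sum fun i _ => ?_)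
  push_cast
  rw [abs_mul, Nat.abs_cast, mul_comm]
  gcongr
  exact abs_mom_le_jap i

theorem abs_momDot_toInt_le_sqrtDeg_sq (q : Idx →₀ ℕ) :
    |(momDot (toInt q) : ℝ)| ≤ sqrtDeg q ^ 2 := by
  refine (abs_momDot_toInt_le q).trans ?_
  simpa only [Nat.reduceAdd, Real.sq_sqrt (jap_pos _).le] using sum_mul_sqrt_jap_pow_le q 1

/-- Concavity of the square root gains half of the remaining degree; this is what pays for the
small divisor. -/
theorem sqrtDeg_div_two_le (hmax : ∀ i ∈ q.support, jap i ≤ jap a)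
    (hm : momDot (subUnit (q + Finsupp.single a 1) k) = 0) :
    sqrtDeg q / 2 ≤ sqrtDeg (q + Finsupp.single a 1) - √(jap k) := by
  have hsum : (q.sum fun i n => (n : ℝ) * jap i) ≤ √(jap a) * sqrtDeg q := by
    rw [sqrtDeg, Finsupp.sum, Finsupp.sum, Finset.mul_sum]
    refine Finset.sum_le_sum fun i hi => ?_
    calc (q i : ℝ) * jap i = √(jap i) * (q i * √(jap i)) := by
          rw [mul_left_comm, Real.mul_self_sqrt (jap_pos i).le]
      _ ≤ √(jap a) * (q i * √(jap i)) := by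
          gcongr
          exact hmax i hi
  have hmom : (mom k : ℝ) = momDot (toInt q) + mom a := by
    rw [momDot_subUnit_add_single] at hm
    exact_mod_cast (by linarith : mom k = momDot (toInt q) + mom a)
  have hT := sqrtDeg_nonneg q
  have hk : jap k ≤ jap a + √(jap a) * sqrtDeg q := by
    rw [jap_eq_max_abs_mom k, Int.cast_max, Int.cast_abs, Int.cast_one, hmom]
    refine max_le ?_ ((one_le_jap a).trans (le_add_of_nonneg_right (by positivity)))
    linarith [abs_add_le (momDot (toInt q) : ℝ) (mom a), abs_momDot_toInt_le q, abs_mom_le_jap a]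
  have hsqrt : √(jap k) ≤ √(jap a) + sqrtDeg q / 2 := by
    refine Real.sqrt_le_iff.2 ⟨by positivity, hk.trans ?_⟩
    nlinarith [Real.sq_sqrt (jap_pos a).le]
  rw [sqrtDeg_add_single]
  linarith

/-! ### Separation of superlinear frequencies -/

theorem IsSuperlinear.abs_norm_sub_sq_le (h : IsSuperlinear lam C) (k : Idx) :
    |‖lam k‖ - jap k ^ 2| ≤ 1 / 2 := by
  obtain ⟨φ, hφ, -⟩ := h
  have hnorm : ‖(jap k : ℂ) ^ 2 * Complex.exp (Complex.I * φ k)‖ = jap k ^ 2 := by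
    rw [norm_mul, mul_comm Complex.I, Complex.norm_exp_ofReal_mul_I, norm_pow, Complex.norm_real,
      Real.norm_of_nonneg (jap_pos k).le, mul_one]
  simpa only [hnorm] using (abs_norm_sub_norm_le _ _).trans (hφ k)

theorem IsSuperlinear.norm_le (h : IsSuperlinear lam C) (k : Idx) :
    ‖lam k‖ ≤ 3 / 2 * jap k ^ 2 := by
  linarith [(abs_le.1 (h.abs_norm_sub_sq_le k)).2, one_le_pow₀ (one_le_jap k) (n := 2)]

theorem IsSuperlinear.ne_zero (h : IsSuperlinear lam C) (k : Idx) : lam k ≠ 0 := by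
  refine norm_pos_iff.1 ?_
  linarith [(abs_le.1 (h.abs_norm_sub_sq_le k)).1, one_le_pow₀ (one_le_jap k) (n := 2)]

theorem IsSuperlinear.norm_freqDot_toInt_le (h : IsSuperlinear lam C) (q : Idx →₀ ℕ) :
    ‖freqDot lam (toInt q)‖ ≤ 3 / 2 * sqrtDeg q ^ 4 := by
  have hpow : ∀ i, √(jap i) ^ 4 = jap i ^ 2 := fun i => by
    rw [pow_mul (√(jap i)) 2 2, Real.sq_sqrt (jap_pos i).le]
  calc ‖freqDot lam (toInt q)‖ ≤ 3 / 2 * q.sum fun i n => (n : ℝ) * √(jap i) ^ 4 := by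
        rw [freqDot_toInt, Finsupp.sum, Finsupp.sum, Finset.mul_sum]
        refine (norm_sum_le _ _).trans (Finset.sum_le_sum fun i _ => ?_)
        rw [norm_mul, Complex.norm_natCast, hpow, mul_left_comm, mul_comm]
        gcongr
        exact h.norm_le i
    _ ≤ 3 / 2 * sqrtDeg q ^ 4 := by
        gcongr
        exact sum_mul_sqrt_jap_pow_le q 3

theorem IsSuperlinear.jap_le_of_jap_ne (h : IsSuperlinear lam C) (hjap : jap a ≠ jap k) :
    jap a ≤ ‖lam a - lam k‖ + 1 := by
  have hsq : |jap a ^ 2 - jap k ^ 2| ≤ ‖lam a - lam k‖ + 1 := by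
    have ha := abs_le.1 (h.abs_norm_sub_sq_le a)
    have hk := abs_le.1 (h.abs_norm_sub_sq_le k)
    have hak := abs_le.1 (abs_norm_sub_norm_le (lam a) (lam k))
    exact abs_le.2 ⟨by linarith, by linarith⟩
  linarith [jap_add_jap_le_abs_sq_sub_sq hjap, jap_pos k]

theorem IsSuperlinear.mul_jap_le_of_mom_eq (h : IsSuperlinear lam C) (hmom : mom a = mom k)
    (hne : lam a ≠ lam k) : C * jap a ≤ ‖lam a - lam k‖ + 1 := by
  obtain ⟨φ, hφ, hsep⟩ := h
  have hk : k = (-a.1, -a.2) :=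
    (eq_or_eq_neg_of_mom_eq hmom).resolve_left fun hka => hne (by rw [hka])
  have hjap : jap k = jap a := by rw [jap_eq_max_abs_mom, jap_eq_max_abs_mom, hmom]
  set ea := Complex.exp (Complex.I * φ a)
  set ek := Complex.exp (Complex.I * φ k)
  have hC : C ≤ ‖ea - ek‖ := by
    have := hsep a.1 a.2
    rw [← hk] at this
    exact this hne
  have hdiff : jap a ^ 2 * ‖ea - ek‖ ≤ ‖lam a - lam k‖ + 1 := by
    have heq : (jap a : ℂ) ^ 2 * (ea - ek)
        = (lam a - lam k) - (lam a - (jap a : ℂ) ^ 2 * ea) + (lam k - (jap a : ℂ) ^ 2 * ek) := by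
      ring
    calc jap a ^ 2 * ‖ea - ek‖ = ‖(jap a : ℂ) ^ 2 * (ea - ek)‖ := by
          rw [norm_mul, norm_pow, Complex.norm_real, Real.norm_of_nonneg (jap_pos a).le]
      _ ≤ ‖lam a - lam k‖ + 1 / 2 + 1 / 2 := by
          rw [heq]
          exact norm_add_le_of_le (norm_sub_le_of_le le_rfl (hφ a)) (hjap ▸ hφ k)
      _ = ‖lam a - lam k‖ + 1 := by ring
  calc C * jap a ≤ ‖ea - ek‖ * jap a ^ 2 := by
        gcongr
        · exact (jap_pos a).le
        · exact le_self_pow₀ (one_le_jap a) two_ne_zero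
    _ ≤ ‖lam a - lam k‖ + 1 := by rwa [mul_comm]

theorem IsSuperlinear.jap_le_of_ne (h : IsSuperlinear lam C) (hC : 0 < C)
    (hne : ¬(lam a = lam k ∧ mom a = mom k)) :
    jap a ≤ (1 + 1 / C) * (‖lam a - lam k‖ + |(mom a : ℝ) - mom k| + 1) := by
  set R := ‖lam a - lam k‖ + |(mom a : ℝ) - mom k| + 1
  have hnorm := norm_nonneg (lam a - lam k)
  have habs := abs_nonneg ((mom a : ℝ) - mom k)
  suffices jap a ≤ R ∨ C * jap a ≤ R by
    have hRC : 0 ≤ R / C := by positivity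
    rw [add_mul, one_mul, one_div_mul_eq_div]
    rcases this with h1 | h1
    · linarith
    · linarith [(le_div_iff₀' hC).2 h1]
  by_cases hmom : mom a = mom k
  · exact .inr (by linarith [h.mul_jap_le_of_mom_eq hmom fun hl => hne ⟨hl, hmom⟩])
  · by_cases hjap : jap a = jap k
    · exact .inl (by linarith [jap_le_abs_mom_sub hjap hmom])
    · exact .inl (by linarith [h.jap_le_of_jap_ne hjap])

/-! ### The Diophantine weight -/

/-- The weight `∏ᵢ (1 + pᵢ² ⟨i⟩²)` of the Diophantine condition. -/
noncomputable def dioWeight (p : Idx →₀ ℤ) : ℝ := p.prod fun i n => 1 + (n : ℝ) ^ 2 * jap i ^ 2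

theorem one_le_dioWeight (p : Idx →₀ ℤ) : 1 ≤ dioWeight p :=
  Finset.one_le_prod fun _ _ => le_add_of_nonneg_right (by positivity)

theorem dioWeight_pos (p : Idx →₀ ℤ) : 0 < dioWeight p := one_pos.trans_le (one_le_dioWeight p)

theorem dioWeight_rpow (p : Idx →₀ ℤ) (τ : ℝ) :
    dioWeight p ^ τ = p.prod fun i n => (1 + (n : ℝ) ^ 2 * jap i ^ 2) ^ τ :=
  (Real.finsetProd_rpow _ _ (fun _ _ => by positivity) _).symm

theorem isDiophantine_iff : IsDiophantine lam γ τ ↔ ∀ p : Idx →₀ ℤ, p ∉ resonances lam →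
    momDot p = 0 → (∃ k, 0 ≤ p + Finsupp.single k 1) → γ / dioWeight p ^ τ ≤ ‖freqDot lam p‖ := by
  simp only [IsDiophantine, dioWeight_rpow, div_eq_mul_inv, one_mul, Finsupp.prod,
    Finset.prod_inv_distrib]

theorem IsDiophantine.mono (h : IsDiophantine lam γ τ) (hγ : 0 ≤ γ) (hτ : τ ≤ τ') :
    IsDiophantine lam γ τ' := by
  rw [isDiophantine_iff] at *
  intro p hp hm hk
  refine le_trans ?_ (h p hp hm hk)
  have := dioWeight_pos p
  gcongr
  exact one_le_dioWeight p

theorem dioWeight_add_single_le (p : Idx →₀ ℤ) (i : Idx) (z : ℤ) :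
    dioWeight (p + Finsupp.single i z) ≤ 2 * (1 + (z : ℝ) ^ 2) * jap i ^ 2 * dioWeight p := by
  have hsplit : ∀ p', (1 + (p' i : ℝ) ^ 2 * jap i ^ 2) * dioWeight (p'.erase i) = dioWeight p' :=
    fun p' => Finsupp.mul_prod_erase' p' i (fun j n => 1 + (n : ℝ) ^ 2 * jap j ^ 2) (by simp)
  have hone : 1 ≤ jap i ^ 2 := one_le_pow₀ (one_le_jap i)
  have hfactor : 1 + ((p i : ℝ) + z) ^ 2 * jap i ^ 2
      ≤ 2 * (1 + (z : ℝ) ^ 2) * jap i ^ 2 * (1 + (p i : ℝ) ^ 2 * jap i ^ 2) := by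
    have hmul : (p i : ℝ) ^ 2 * jap i ^ 2
        ≤ (1 + (z : ℝ) ^ 2) * jap i ^ 2 * ((p i : ℝ) ^ 2 * jap i ^ 2) :=
      le_mul_of_one_le_left (by positivity)
        (one_le_mul_of_one_le_of_one_le (le_add_of_nonneg_right (sq_nonneg _)) hone)
    nlinarith [mul_nonneg (sq_nonneg ((p i : ℝ) - z)) (sq_nonneg (jap i))]
  calc dioWeight (p + Finsupp.single i z)
      = (1 + ((p i : ℝ) + z) ^ 2 * jap i ^ 2) * dioWeight (p.erase i) := by
        rw [← hsplit, Finsupp.erase_add, Finsupp.erase_single, add_zero, Finsupp.add_apply,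
          Finsupp.single_eq_same, Int.cast_add]
    _ ≤ 2 * (1 + (z : ℝ) ^ 2) * jap i ^ 2 * (1 + (p i : ℝ) ^ 2 * jap i ^ 2)
          * dioWeight (p.erase i) := by
        have := (dioWeight_pos (p.erase i)).le
        gcongr
    _ = 2 * (1 + (z : ℝ) ^ 2) * jap i ^ 2 * dioWeight p := by
        rw [mul_assoc _ _ (dioWeight _), hsplit]

theorem dioWeight_subUnit_add_single_le (q : Idx →₀ ℕ) (a k : Idx) :
    dioWeight (subUnit (q + Finsupp.single a 1) k)
      ≤ (2 * jap k) ^ 2 * ((2 * jap a) ^ 2 * dioWeight (toInt q)) := by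
  rw [subUnit_add_single, sub_eq_add_neg, ← Finsupp.single_neg]
  refine (dioWeight_add_single_le _ _ _).trans ?_
  have hk : 2 * (1 + ((-1 : ℤ) : ℝ) ^ 2) * jap k ^ 2 = (2 * jap k) ^ 2 := by push_cast; ring
  have ha : 2 * (1 + ((1 : ℤ) : ℝ) ^ 2) * jap a ^ 2 = (2 * jap a) ^ 2 := by push_cast; ring
  rw [hk]
  gcongr
  exact (dioWeight_add_single_le _ _ _).trans_eq (by rw [ha])

theorem one_add_pow_four_le_exp {w : ℝ} (hw : 0 ≤ w) : 1 + w ^ 4 ≤ Real.exp (8 * √w) := by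
  calc 1 + w ^ 4 = 1 ^ 8 + √w ^ 8 := by rw [one_pow, pow_mul (√w) 2 4, Real.sq_sqrt hw]
    _ ≤ (1 + √w) ^ 8 := pow_add_pow_le zero_le_one (Real.sqrt_nonneg w) (by norm_num)
    _ ≤ Real.exp √w ^ 8 := by
        gcongr
        linarith [Real.add_one_le_exp √w]
    _ = Real.exp (8 * √w) := by rw [← Real.exp_nat_mul]; norm_num

theorem mul_le_mul_sq_add {b u : ℝ} (hb : 0 ≤ b) (hε : 0 < ε) (hu : 0 < u) :
    b * u ≤ ε * u ^ 2 + b ^ 7 / ε ^ 6 * (u ^ 5)⁻¹ := by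
  rcases le_total b (ε * u) with h | h
  · calc b * u ≤ ε * u * u := by gcongr
      _ = ε * u ^ 2 := by ring
      _ ≤ ε * u ^ 2 + b ^ 7 / ε ^ 6 * (u ^ 5)⁻¹ := le_add_of_nonneg_right (by positivity)
  · calc b * u = b * u ^ 6 * (u ^ 5)⁻¹ := by field_simp
      _ ≤ b * (b / ε) ^ 6 * (u ^ 5)⁻¹ := by
          gcongr
          exact (le_div_iff₀' hε).2 h
      _ = b ^ 7 / ε ^ 6 * (u ^ 5)⁻¹ := by ring
      _ ≤ ε * u ^ 2 + b ^ 7 / ε ^ 6 * (u ^ 5)⁻¹ := le_add_of_nonneg_left (by positivity)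

theorem one_add_pow_four_rpow_le {w : ℝ} (hτ : 0 ≤ τ) (hε : 0 < ε) (hw : 0 < w) :
    (1 + w ^ 4) ^ τ ≤ Real.exp (ε * w + (8 * τ) ^ 7 / ε ^ 6 * w ^ (-(5 / 2) : ℝ)) := by
  calc (1 + w ^ 4) ^ τ ≤ Real.exp (8 * √w) ^ τ := by
        gcongr
        exact one_add_pow_four_le_exp hw.le
    _ = Real.exp (8 * τ * √w) := by rw [← Real.exp_mul]; ring_nf
    _ ≤ Real.exp (ε * √w ^ 2 + (8 * τ) ^ 7 / ε ^ 6 * (√w ^ 5)⁻¹) :=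
        Real.exp_le_exp.2 (mul_le_mul_sq_add (by positivity) hε (Real.sqrt_pos.2 hw))
    _ = Real.exp (ε * w + (8 * τ) ^ 7 / ε ^ 6 * w ^ (-(5 / 2) : ℝ)) := by
        have hpow : (√w ^ 5)⁻¹ = w ^ (-(5 / 2) : ℝ) := by
          rw [Real.sqrt_eq_rpow, ← Real.rpow_natCast, ← Real.rpow_mul hw.le, ← Real.rpow_neg hw.le]
          norm_num
        rw [Real.sq_sqrt hw.le, hpow]

theorem one_add_sqrtDeg_pow_four_rpow_le (hτ : 0 ≤ τ) (hε : 0 < ε) (q : Idx →₀ ℕ) :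
    (1 + sqrtDeg q ^ 4) ^ τ ≤ Real.exp (ε * sqrtDeg q + (8 * τ) ^ 7 / ε ^ 6) := by
  rcases sqrtDeg_eq_zero_or_one_le q with h | h
  · rw [h, zero_pow four_ne_zero, add_zero, Real.one_rpow]
    exact Real.one_le_exp (by positivity)
  · refine (one_add_pow_four_rpow_le hτ hε (by linarith)).trans ?_
    gcongr
    exact mul_le_of_le_one_right (by positivity)
      (Real.rpow_le_one_of_one_le_of_nonpos h (by norm_num))

theorem one_add_sq_mul_sq_rpow_le {n J : ℝ} (hτ : 0 ≤ τ) (hε : 0 < ε) (hn : 1 ≤ n) (hJ : 1 ≤ J) :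
    (1 + n ^ 2 * J ^ 2) ^ τ
      ≤ Real.exp (ε * (n * √J) + (8 * τ) ^ 7 / ε ^ 6 * J ^ (-(5 / 4) : ℝ)) := by
  have hJ0 : 0 < J := one_pos.trans_le hJ
  have hbase : n ^ 2 * J ^ 2 ≤ (n * √J) ^ 4 := by
    rw [mul_pow, pow_mul (√J) 2 2, Real.sq_sqrt hJ0.le]
    gcongr
    norm_num
  have hdecay : (n * √J) ^ (-(5 / 2) : ℝ) ≤ J ^ (-(5 / 4) : ℝ) := by
    calc (n * √J) ^ (-(5 / 2) : ℝ) ≤ √J ^ (-(5 / 2) : ℝ) :=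
          Real.rpow_le_rpow_of_nonpos (Real.sqrt_pos.2 hJ0)
            (le_mul_of_one_le_left (Real.sqrt_nonneg J) hn) (by norm_num)
      _ = J ^ (-(5 / 4) : ℝ) := by
          rw [Real.sqrt_eq_rpow, ← Real.rpow_mul hJ0.le]
          norm_num
  calc (1 + n ^ 2 * J ^ 2) ^ τ ≤ (1 + (n * √J) ^ 4) ^ τ := by gcongr
    _ ≤ _ := one_add_pow_four_rpow_le hτ hε (by positivity)
    _ ≤ _ := by gcongr

theorem summable_jap_rpow {e : ℝ} (he : 1 < e) : Summable fun k : Idx => jap k ^ (-e) := by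
  have hint : Summable fun j : ℤ => (max |(j : ℝ)| 1) ^ (-e) := by
    refine (Real.summable_abs_int_rpow he).congr_cofinite ?_
    filter_upwards [(Set.finite_singleton (0 : ℤ)).compl_mem_cofinite] with j hj
    rw [max_eq_left (by exact_mod_cast Int.one_le_abs hj)]
  rw [← (Equiv.prodComm ℤˣ ℤ).summable_iff]
  exact (summable_prod_of_nonneg fun _ => Real.rpow_nonneg (jap_pos _).le _).2
    ⟨fun _ => hint, (hasSum_fintype _).summable⟩

theorem dioWeight_toInt_rpow_le (hτ : 0 ≤ τ) (hε : 0 < ε) (q : Idx →₀ ℕ) :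
    dioWeight (toInt q) ^ τ ≤ Real.exp
      (ε * sqrtDeg q + (8 * τ) ^ 7 / ε ^ 6 * ∑' k : Idx, jap k ^ (-(5 / 4) : ℝ)) := by
  rw [dioWeight_rpow, toInt, Finsupp.prod_mapRange_index (by simp), Finsupp.prod]
  calc _ ≤ ∏ i ∈ q.support, Real.exp (ε * (q i * √(jap i))
          + (8 * τ) ^ 7 / ε ^ 6 * jap i ^ (-(5 / 4) : ℝ)) := by
        refine Finset.prod_le_prod (fun _ _ => by positivity) fun i hi => ?_
        have hqi : (1 : ℝ) ≤ q i := by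
          exact_mod_cast Nat.one_le_iff_ne_zero.2 (Finsupp.mem_support_iff.1 hi)
        simpa only [Int.cast_natCast] using one_add_sq_mul_sq_rpow_le hτ hε hqi (one_le_jap i)
    _ = Real.exp (ε * sqrtDeg q
          + (8 * τ) ^ 7 / ε ^ 6 * ∑ i ∈ q.support, jap i ^ (-(5 / 4) : ℝ)) := by
        rw [← Real.exp_sum, Finset.sum_add_distrib, ← Finset.mul_sum, ← Finset.mul_sum]
        rfl
    _ ≤ _ := by
        gcongr
        exact (summable_jap_rpow (by norm_num)).sum_le_tsum _
          fun k _ => Real.rpow_nonneg (jap_pos k).le _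

/-! ### Small divisors -/

theorem IsDiophantine.inv_norm_le (h : IsDiophantine lam γ τ) (hγ : 0 < γ)
    (hf : freqDot lam p ≠ 0) (hm : momDot p = 0) (hk : 0 ≤ p + Finsupp.single k 1) :
    ‖freqDot lam p‖⁻¹ ≤ γ⁻¹ * dioWeight p ^ τ := by
  have hdio := isDiophantine_iff.1 h p (fun hp => hf hp.1) hm ⟨k, hk⟩
  have := dioWeight_pos p
  rw [inv_mul_eq_div, ← inv_div]
  exact inv_anti₀ (by positivity) hdio

theorem IsDiophantine.le_two_mul_two_rpow (h : IsDiophantine lam γ τ)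
    (hlam : IsSuperlinear lam C) : γ ≤ 2 * 2 ^ τ := by
  set k : Idx := (0, 1)
  have hjap : jap k = 1 := by simp [jap, k]
  have hweight : dioWeight (Finsupp.single k 1) = 2 := by
    rw [dioWeight, Finsupp.prod_single_index (by simp), hjap]
    norm_num
  have hdio := isDiophantine_iff.1 h (Finsupp.single k 1)
    (fun hr => hlam.ne_zero k (by rw [← freqDot_single lam, hr.1]))
    (by simp [momDot_single, mom, k])
    ⟨k, add_nonneg (Finsupp.single_nonneg.2 zero_le_one) (Finsupp.single_nonneg.2 zero_le_one)⟩
  rw [freqDot_single, hweight, div_le_iff₀ (by positivity)] at hdio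
  have hnorm : ‖lam k‖ ≤ 2 := by linarith [hjap ▸ hlam.norm_le k]
  exact hdio.trans (by gcongr)

/-- With the largest factor `x_a` of the monomial singled out, the constant such that, unless `a`
and `k` cancel, a small divisor forces `2 ⟨a⟩, 2 ⟨k⟩ ≤ sepConst C * (1 + sqrtDeg q ^ 4)`, where `q`
collects the remaining factors. -/
noncomputable def sepConst (C : ℝ) : ℝ := 6 * (1 + 1 / C)

theorem six_le_sepConst (hC : 0 < C) : 6 ≤ sepConst C := by
  have : 0 ≤ 1 / C := by positivity
  rw [sepConst]
  linarith

theorem IsSuperlinear.two_mul_jap_le (hlam : IsSuperlinear lam C) (hC : 0 < C)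
    (hm : momDot (subUnit (q + Finsupp.single a 1) k) = 0)
    (hf : ‖freqDot lam (subUnit (q + Finsupp.single a 1) k)‖ ≤ 1)
    (hne : ¬(lam a = lam k ∧ mom a = mom k)) :
    2 * jap a ≤ sepConst C * (1 + sqrtDeg q ^ 4) ∧
      2 * jap k ≤ sepConst C * (1 + sqrtDeg q ^ 4) := by
  have hfreq : ‖lam a - lam k‖ ≤ 1 + 3 / 2 * sqrtDeg q ^ 4 := by
    rw [freqDot_subUnit_add_single] at hf
    calc ‖lam a - lam k‖
        = ‖(freqDot lam (toInt q) + (lam a - lam k)) - freqDot lam (toInt q)‖ := by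
          rw [add_sub_cancel_left]
      _ ≤ 1 + 3 / 2 * sqrtDeg q ^ 4 := norm_sub_le_of_le hf (hlam.norm_freqDot_toInt_le q)
  have hmom : |(mom a : ℝ) - mom k| ≤ sqrtDeg q ^ 2 := by
    rw [momDot_subUnit_add_single] at hm
    have hdiff : (mom a : ℝ) - mom k = -momDot (toInt q) := by
      exact_mod_cast eq_neg_of_add_eq_zero_right hm
    rw [hdiff, abs_neg]
    exact abs_momDot_toInt_le_sqrtDeg_sq q
  have hsum : ‖lam a - lam k‖ + |(mom a : ℝ) - mom k| + 1 ≤ 3 * (1 + sqrtDeg q ^ 4) := by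
    nlinarith [sq_nonneg (sqrtDeg q ^ 2 - 1)]
  have hmul : 2 * ((1 + 1 / C) * (‖lam a - lam k‖ + |(mom a : ℝ) - mom k| + 1))
      ≤ sepConst C * (1 + sqrtDeg q ^ 4) := by
    calc _ ≤ 2 * ((1 + 1 / C) * (3 * (1 + sqrtDeg q ^ 4))) := by gcongr
      _ = _ := by rw [sepConst]; ring
  have ha := hlam.jap_le_of_ne hC hne
  have hk := hlam.jap_le_of_ne hC (a := k) (k := a) fun h => hne ⟨h.1.symm, h.2.symm⟩
  rw [norm_sub_rev, abs_sub_comm] at hk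
  constructor <;> linarith

theorem two_le_sepConst_mul (hC : 0 < C) (q : Idx →₀ ℕ) :
    2 ≤ sepConst C * (1 + sqrtDeg q ^ 4) := by
  have : 0 ≤ sqrtDeg q ^ 4 := by positivity
  nlinarith [six_le_sepConst hC]

theorem IsDiophantine.inv_norm_freqDot_le_of_norm_le_one (hdio : IsDiophantine lam γ τ)
    (hγ : 0 < γ) (hτ : 0 ≤ τ) (hlam : IsSuperlinear lam C) (hC : 0 < C)
    (hm : momDot (subUnit (q + Finsupp.single a 1) k) = 0)
    (hf : freqDot lam (subUnit (q + Finsupp.single a 1) k) ≠ 0)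
    (hsmall : ‖freqDot lam (subUnit (q + Finsupp.single a 1) k)‖ ≤ 1) :
    ‖freqDot lam (subUnit (q + Finsupp.single a 1) k)‖⁻¹
      ≤ γ⁻¹ * ((sepConst C * (1 + sqrtDeg q ^ 4)) ^ 4 * dioWeight (toInt q)) ^ τ := by
  have hW := dioWeight_pos (toInt q)
  by_cases hcancel : lam a = lam k ∧ mom a = mom k
  · rw [freqDot_subUnit_add_single, hcancel.1, sub_self, add_zero] at hf ⊢
    rw [momDot_subUnit_add_single, hcancel.2, sub_self, add_zero] at hm
    refine (hdio.inv_norm_le hγ hf hm (toInt_add_single_nonneg q k)).trans ?_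
    gcongr
    exact le_mul_of_one_le_left hW.le
      (one_le_pow₀ (one_le_two.trans (two_le_sepConst_mul hC q)))
  · obtain ⟨ha, hk⟩ := hlam.two_mul_jap_le hC hm hsmall hcancel
    have ha0 := (jap_pos a).le
    have hk0 := (jap_pos k).le
    have hnonneg : 0 ≤ subUnit (q + Finsupp.single a 1) k + Finsupp.single k 1 := by
      rw [subUnit, sub_add_cancel]
      exact fun _ => Int.natCast_nonneg _
    have hweight : dioWeight (subUnit (q + Finsupp.single a 1) k)
        ≤ (sepConst C * (1 + sqrtDeg q ^ 4)) ^ 4 * dioWeight (toInt q) := by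
      set L := sepConst C * (1 + sqrtDeg q ^ 4)
      calc _ ≤ (2 * jap k) ^ 2 * ((2 * jap a) ^ 2 * dioWeight (toInt q)) :=
            dioWeight_subUnit_add_single_le q a k
        _ ≤ L ^ 2 * (L ^ 2 * dioWeight (toInt q)) := by gcongr
        _ = L ^ 4 * dioWeight (toInt q) := by ring
    refine (hdio.inv_norm_le hγ hf hm hnonneg).trans ?_
    have := (dioWeight_pos (subUnit (q + Finsupp.single a 1) k)).le
    gcongr

theorem IsDiophantine.inv_norm_freqDot_le (hdio : IsDiophantine lam γ τ) (hγ : 0 < γ)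
    (hτ : 0 ≤ τ) (hlam : IsSuperlinear lam C) (hC : 0 < C)
    (hm : momDot (subUnit (q + Finsupp.single a 1) k) = 0)
    (hf : freqDot lam (subUnit (q + Finsupp.single a 1) k) ≠ 0) :
    ‖freqDot lam (subUnit (q + Finsupp.single a 1) k)‖⁻¹
      ≤ 2 * γ⁻¹ * ((sepConst C * (1 + sqrtDeg q ^ 4)) ^ 4 * dioWeight (toInt q)) ^ τ := by
  have hW := one_le_dioWeight (toInt q)
  rcases le_total 1 ‖freqDot lam (subUnit (q + Finsupp.single a 1) k)‖ with hbig | hsmall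
  · have hL := two_le_sepConst_mul hC q
    calc _ ≤ γ⁻¹ * γ := by rw [inv_mul_cancel₀ hγ.ne']; exact inv_le_one_of_one_le₀ hbig
      _ ≤ γ⁻¹ * (2 * 2 ^ τ) := by gcongr; exact hdio.le_two_mul_two_rpow hlam
      _ = 2 * γ⁻¹ * 2 ^ τ := by ring
      _ ≤ _ := by
        gcongr
        exact (hL.trans (le_self_pow₀ (by linarith) four_ne_zero)).trans
          (le_mul_of_one_le_right (by positivity) hW)
  · refine (hdio.inv_norm_freqDot_le_of_norm_le_one hγ hτ hlam hC hm hf hsmall).trans ?_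
    gcongr
    exact le_mul_of_one_le_left (by positivity) one_le_two

/-- The constant `c` in the factor `exp (c / δ ^ 6)` lost to the small divisors; `4 ^ 6` comes from
spending the fraction `δ / 4` of the gain on each of two factors. -/
noncomputable def lossConst (τ : ℝ) : ℝ :=
  4 ^ 6 * ((32 * τ) ^ 7 + (8 * τ) ^ 7 * ∑' k : Idx, jap k ^ (-(5 / 4) : ℝ))

theorem lossConst_pos (hτ : 0 < τ) : 0 < lossConst τ := by
  have hsum : 0 ≤ ∑' k : Idx, jap k ^ (-(5 / 4) : ℝ) :=
    tsum_nonneg fun k => Real.rpow_nonneg (jap_pos k).le _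
  unfold lossConst
  positivity

theorem sepConst_mul_rpow_le (hτ : 0 ≤ τ) (hC : 0 < C) (hδ : 0 < δ) (q : Idx →₀ ℕ) :
    ((sepConst C * (1 + sqrtDeg q ^ 4)) ^ 4 * dioWeight (toInt q)) ^ τ
      ≤ sepConst C ^ (4 * τ) * Real.exp (lossConst τ / δ ^ 6 + δ * (sqrtDeg q / 2)) := by
  have hS : 0 < sepConst C := by linarith [six_le_sepConst hC]
  have hW := (dioWeight_pos (toInt q)).le
  have hpow : ((sepConst C * (1 + sqrtDeg q ^ 4)) ^ 4) ^ τ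
      = sepConst C ^ (4 * τ) * (1 + sqrtDeg q ^ 4) ^ (4 * τ) := by
    rw [← Real.mul_rpow hS.le (by positivity), Real.rpow_mul (by positivity)]
    norm_cast
  rw [Real.mul_rpow (by positivity) hW, hpow, mul_assoc]
  gcongr
  calc (1 + sqrtDeg q ^ 4) ^ (4 * τ) * dioWeight (toInt q) ^ τ
      ≤ Real.exp (δ / 4 * sqrtDeg q + (8 * (4 * τ)) ^ 7 / (δ / 4) ^ 6)
        * Real.exp (δ / 4 * sqrtDeg q
          + (8 * τ) ^ 7 / (δ / 4) ^ 6 * ∑' k : Idx, jap k ^ (-(5 / 4) : ℝ)) := by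
        gcongr
        · exact one_add_sqrtDeg_pow_four_rpow_le (by positivity) (by positivity) q
        · exact dioWeight_toInt_rpow_le hτ (by positivity) q
    _ = Real.exp (lossConst τ / δ ^ 6 + δ * (sqrtDeg q / 2)) := by
        rw [← Real.exp_add, lossConst]
        congr 1
        field

/-- The multiplicative constant in the small divisor estimate. -/
noncomputable def divisorConst (τ C : ℝ) : ℝ := 2 * sepConst C ^ (4 * τ)

theorem divisorConst_pos (τ : ℝ) (hC : 0 < C) : 0 < divisorConst τ C := by
  have : 0 < sepConst C := by linarith [six_le_sepConst hC]
  unfold divisorConst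
  positivity

theorem IsDiophantine.inv_norm_freqDot_le_exp (hdio : IsDiophantine lam γ τ) (hγ : 0 < γ)
    (hτ : 0 ≤ τ) (hlam : IsSuperlinear lam C) (hC : 0 < C) (hδ : 0 < δ) (hq : q ≠ 0)
    (hm : momDot (subUnit q k) = 0) (hf : freqDot lam (subUnit q k) ≠ 0) :
    ‖freqDot lam (subUnit q k)‖⁻¹ ≤ divisorConst τ C * Real.exp (lossConst τ / δ ^ 6) * γ⁻¹
      * Real.exp (δ * (sqrtDeg q - √(jap k))) := by
  obtain ⟨q, a, rfl, hmax⟩ := exists_eq_add_single_of_jap_le hq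
  calc _ ≤ _ := hdio.inv_norm_freqDot_le hγ hτ hlam hC hm hf
    _ ≤ 2 * γ⁻¹ * (sepConst C ^ (4 * τ)
          * Real.exp (lossConst τ / δ ^ 6 + δ * (sqrtDeg q / 2))) := by
        gcongr
        exact sepConst_mul_rpow_le hτ hC hδ q
    _ = divisorConst τ C * Real.exp (lossConst τ / δ ^ 6) * γ⁻¹
          * Real.exp (δ * (sqrtDeg q / 2)) := by
        rw [Real.exp_add, divisorConst]
        ring
    _ ≤ _ := by
        have := divisorConst_pos τ hC
        gcongr
        exact sqrtDeg_div_two_le hmax hm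

/-! ### Rescaling of majorant norms -/

/-- The dilation `x_k ↦ e^{δ √⟨k⟩} x_k`, which maps `g_{s+δ}` isometrically onto `g_s`. -/
noncomputable def dilate (δ : ℝ) (x : Idx → ℂ) (k : Idx) : ℂ :=
  (Real.exp (δ * √(jap k)) : ℂ) * x k

theorem enorm_dilate (δ : ℝ) (x : Idx → ℂ) (k : Idx) :
    ‖dilate δ x k‖ₑ = ENNReal.ofReal (Real.exp (δ * √(jap k))) * ‖x k‖ₑ := by
  rw [dilate, enorm_mul, ← ofReal_norm, Complex.norm_real,
    Real.norm_of_nonneg (Real.exp_pos _).le]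

theorem prod_enorm_dilate (δ : ℝ) (x : Idx → ℂ) (q : Idx →₀ ℕ) :
    (q.prod fun h n => ‖dilate δ x h‖ₑ ^ n)
      = ENNReal.ofReal (Real.exp (δ * sqrtDeg q)) * q.prod fun h n => ‖x h‖ₑ ^ n := by
  have hexp : ENNReal.ofReal (Real.exp (δ * sqrtDeg q))
      = q.prod fun h n => ENNReal.ofReal (Real.exp (δ * √(jap h))) ^ n := by
    rw [sqrtDeg, Finsupp.sum, Finset.mul_sum, Real.exp_sum,
      ENNReal.ofReal_prod_of_nonneg fun _ _ => (Real.exp_pos _).le]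
    refine Finset.prod_congr rfl fun h _ => ?_
    beta_reduce
    rw [← ENNReal.ofReal_pow (Real.exp_pos _).le, ← Real.exp_nat_mul, mul_left_comm]
  simp only [enorm_dilate, mul_pow, Finsupp.prod_mul, hexp]

theorem gNorm_add (s δ : ℝ) (b : Idx → ℝ≥0∞) :
    gNorm (s + δ) b = gNorm s fun k => ENNReal.ofReal (Real.exp (δ * √(jap k))) * b k := by
  unfold gNorm
  congr 1
  refine tsum_congr fun k => ?_
  have hexp : Real.exp (2 * (s + δ) * √(jap k))
      = Real.exp (2 * s * √(jap k)) * Real.exp (δ * √(jap k)) ^ 2 := by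
    rw [← Real.exp_nat_mul, ← Real.exp_add]
    congr 1
    push_cast
    ring
  rw [mul_pow, ← mul_assoc, ← ENNReal.ofReal_pow (Real.exp_pos _).le,
    ← ENNReal.ofReal_mul (by positivity), hexp, ← mul_assoc (jap k ^ 2)]

theorem gNorm_mono (s : ℝ) : Monotone (gNorm s) := by
  intro b b' h
  unfold gNorm
  gcongr with k
  exact h k

theorem gNorm_const_mul (s : ℝ) (c : ℝ≥0∞) (b : Idx → ℝ≥0∞) :
    gNorm s (fun k => c * b k) = c * gNorm s b := by
  simp only [gNorm, mul_pow, mul_left_comm _ (c ^ 2)]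
  rw [ENNReal.tsum_mul_left, ENNReal.mul_rpow_of_nonneg _ _ (by norm_num), ← ENNReal.rpow_natCast,
    ← ENNReal.rpow_mul, Nat.cast_two, mul_one_div_cancel two_ne_zero, ENNReal.rpow_one]

theorem dilate_mem_gBall {x : Idx → ℂ} (hx : x ∈ gBall (s + δ) r) : dilate δ x ∈ gBall s r := by
  simp only [gBall, Set.mem_ofPred_eq, enorm_dilate] at *
  rwa [← gNorm_add]

variable {κ : ℝ} {X Y : FormalVF}

theorem exp_mul_majorant_le (h : ∀ q, ‖MvPowerSeries.coeff q (X k)‖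
      ≤ κ * Real.exp (δ * (sqrtDeg q - √(jap k))) * ‖MvPowerSeries.coeff q (Y k)‖)
    (x : Idx → ℂ) :
    ENNReal.ofReal (Real.exp (δ * √(jap k))) * majorant X x k
      ≤ ENNReal.ofReal κ * majorant Y (dilate δ x) k := by
  have hcoeff : ∀ q, ENNReal.ofReal (Real.exp (δ * √(jap k))) * ‖MvPowerSeries.coeff q (X k)‖ₑ
      ≤ ENNReal.ofReal κ * ‖MvPowerSeries.coeff q (Y k)‖ₑ
        * ENNReal.ofReal (Real.exp (δ * sqrtDeg q)) := by
    intro q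
    rw [← ofReal_norm, ← ofReal_norm, ← ENNReal.ofReal_mul (Real.exp_pos _).le,
      ← ENNReal.ofReal_mul' (norm_nonneg _), ← ENNReal.ofReal_mul' (Real.exp_pos _).le]
    refine ENNReal.ofReal_le_ofReal ?_
    calc _ ≤ Real.exp (δ * √(jap k)) * (κ * Real.exp (δ * (sqrtDeg q - √(jap k)))
          * ‖MvPowerSeries.coeff q (Y k)‖) := by gcongr; exact h q
      _ = κ * ‖MvPowerSeries.coeff q (Y k)‖ *
          (Real.exp (δ * √(jap k)) * Real.exp (δ * (sqrtDeg q - √(jap k)))) := by ring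
      _ = _ := by rw [← Real.exp_add, ← mul_add, add_sub_cancel]
  unfold majorant
  rw [← ENNReal.tsum_mul_left, ← ENNReal.tsum_mul_left]
  refine ENNReal.tsum_le_tsum fun q => ?_
  rw [prod_enorm_dilate, ← mul_assoc, ← mul_assoc, ← mul_assoc]
  gcongr ?_ * _
  exact hcoeff q

theorem majNorm_add_le (h : ∀ k q, ‖MvPowerSeries.coeff q (X k)‖
      ≤ κ * Real.exp (δ * (sqrtDeg q - √(jap k))) * ‖MvPowerSeries.coeff q (Y k)‖) :
    majNorm (s + δ) r X ≤ ENNReal.ofReal κ * majNorm s r Y := by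
  unfold majNorm
  rw [mul_left_comm]
  gcongr
  refine iSup₂_le fun x hx => ?_
  calc gNorm (s + δ) (majorant X x)
      = gNorm s fun k => ENNReal.ofReal (Real.exp (δ * √(jap k))) * majorant X x k :=
        gNorm_add _ _ _
    _ ≤ gNorm s fun k => ENNReal.ofReal κ * majorant Y (dilate δ x) k :=
        gNorm_mono s fun k => exp_mul_majorant_le (h k) x
    _ = ENNReal.ofReal κ * gNorm s (majorant Y (dilate δ x)) := gNorm_const_mul _ _ _
    _ ≤ _ := by
        gcongr
        exact le_iSup₂ (f := fun y (_ : y ∈ gBall s r) => gNorm s (majorant Y y)) _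
          (dilate_mem_gBall hx)

/-! ### The homological equation -/

/-- The inverse of `L_lam` on fields without resonant monomials; on resonant monomials the
convention `0⁻¹ = 0` gives the coefficient `0`. -/
noncomputable def solveDiag (lam : Idx → ℂ) (Y : FormalVF) : FormalVF :=
  fun k q => (freqDot lam (subUnit q k))⁻¹ * MvPowerSeries.coeff q (Y k)

theorem coeff_solveDiag (lam : Idx → ℂ) (Y : FormalVF) (k : Idx) (q : Idx →₀ ℕ) :
    MvPowerSeries.coeff q (solveDiag lam Y k)
      = (freqDot lam (subUnit q k))⁻¹ * MvPowerSeries.coeff q (Y k) := rfl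

theorem lieDiag_solveDiag
    (hY : ∀ k q, freqDot lam (subUnit q k) = 0 → MvPowerSeries.coeff q (Y k) = 0) :
    lieDiag lam (solveDiag lam Y) = Y := by
  funext k
  ext q
  rw [coeff_lieDiag, coeff_solveDiag]
  by_cases h : freqDot lam (subUnit q k) = 0
  · rw [hY k q h, mul_zero, mul_zero]
  · rw [mul_inv_cancel_left₀ h]

theorem solveDiag_lieDiag
    (hX : ∀ k q, freqDot lam (subUnit q k) = 0 → MvPowerSeries.coeff q (X k) = 0) :
    solveDiag lam (lieDiag lam X) = X := by
  funext k
  ext q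
  rw [coeff_solveDiag, coeff_lieDiag]
  by_cases h : freqDot lam (subUnit q k) = 0
  · rw [hX k q h, mul_zero, mul_zero]
  · rw [inv_mul_cancel_left₀ h]

theorem majNorm_solveDiag_le (hdio : IsDiophantine lam γ τ) (hγ : 0 < γ) (hτ : 0 ≤ τ)
    (hlam : IsSuperlinear lam C) (hC : 0 < C) (hδ : 0 < δ) (hY : Y ∈ rangeSpace lam s r) :
    majNorm (s + δ) r (solveDiag lam Y)
      ≤ ENNReal.ofReal (divisorConst τ C * Real.exp (lossConst τ / δ ^ 6) * γ⁻¹)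
        * majNorm s r Y := by
  obtain ⟨⟨hY0, hYm, -⟩, hYr⟩ := hY
  refine majNorm_add_le fun k q => ?_
  rw [coeff_solveDiag, norm_mul, norm_inv]
  by_cases hzero : MvPowerSeries.coeff q (Y k) = 0
  · simp [hzero]
  · gcongr
    refine hdio.inv_norm_freqDot_le_exp hγ hτ hlam hC hδ ?_ ?_ fun h => hzero (hYr k q h)
    · rintro rfl
      exact hzero (hY0 k)
    · exact not_not.1 fun h => hzero (hYm k q h)

theorem solveDiag_mem_rangeSpace {s' : ℝ} (hY : Y ∈ rangeSpace lam s r)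
    (hfin : majNorm s' r (solveDiag lam Y) < ∞) : solveDiag lam Y ∈ rangeSpace lam s' r := by
  obtain ⟨⟨hY0, hYm, -⟩, hYr⟩ := hY
  have hcoeff : ∀ k q, MvPowerSeries.coeff q (Y k) = 0 →
      MvPowerSeries.coeff q (solveDiag lam Y k) = 0 :=
    fun k q h => by rw [coeff_solveDiag, h, mul_zero]
  exact ⟨⟨fun k => hcoeff k 0 (hY0 k), fun k q h => hcoeff k q (hYm k q h), hfin⟩,
    fun k q h => hcoeff k q (hYr k q h)⟩

end AnalyticVF

theorem proposition4p2_general (τ : ℝ) {C : ℝ} (hC : 0 < C) :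
    ∃ c > (0 : ℝ), ∃ K > (0 : ℝ),
      ∀ (γ : ℝ), 0 < γ → ∀ lam : Idx → ℂ, IsSuperlinear lam C → IsDiophantine lam γ τ →
      ∀ s r : ℝ, 0 < r → ∀ Y ∈ rangeSpace lam s r,
        ∃ X : FormalVF, lieDiag lam X = Y ∧
          ∀ δ : ℝ, 0 < δ →
            X ∈ rangeSpace lam (s + δ) r ∧
            (∀ X' ∈ rangeSpace lam (s + δ) r, lieDiag lam X' = Y → X' = X) ∧
            majNorm (s + δ) r X
              ≤ ENNReal.ofReal (K * Real.exp (c / δ ^ 6) * γ⁻¹) * majNorm s r Y := by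
  have hτ : 0 < max τ 1 := lt_max_of_lt_right one_pos
  refine ⟨lossConst (max τ 1), lossConst_pos hτ, divisorConst (max τ 1) C,
    divisorConst_pos _ hC, fun γ hγ lam hlam hdio s r _ Y hY => ?_⟩
  refine ⟨solveDiag lam Y, lieDiag_solveDiag hY.2, fun δ hδ => ?_⟩
  have hbound := majNorm_solveDiag_le (hdio.mono hγ.le (le_max_left τ 1)) hγ hτ.le hlam hC hδ hY
  have hfin := hbound.trans_lt (ENNReal.mul_lt_top ENNReal.ofReal_lt_top hY.1.2.2)
  refine ⟨solveDiag_mem_rangeSpace hY hfin, fun X' hX' hL => ?_, hbound⟩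
  rw [← hL, solveDiag_lieDiag hX'.2]

theorem proposition4p2 (τ : ℝ) (hτ : 0 < τ) (C : ℝ) (hC : 0 < C) :
    ∃ c > (0 : ℝ), ∃ K > (0 : ℝ),
      ∀ (γ : ℝ), 0 < γ → ∀ lam : Idx → ℂ, (∀ k, lam k ≠ 0) →
        IsSuperlinear lam C → IsDiophantine lam γ τ →
      ∀ s r : ℝ, 0 < s → 0 < r → ∀ Y ∈ rangeSpace lam s r,
        ∃ X : FormalVF, lieDiag lam X = Y ∧
          ∀ δ : ℝ, 0 < δ →
            X ∈ rangeSpace lam (s + δ) r ∧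
            (∀ X' ∈ rangeSpace lam (s + δ) r, lieDiag lam X' = Y → X' = X) ∧
            majNorm (s + δ) r X
              ≤ ENNReal.ofReal (K * Real.exp (c / δ ^ 6) * γ⁻¹) * majNorm s r Y := by
  obtain ⟨c, hc, K, hK, h⟩ := proposition4p2_general τ hC
  exact ⟨c, hc, K, hK, fun γ hγ lam _ hlam hdio s r _ => h γ hγ lam hlam hdio s r⟩
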